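/- Let $1\le p<\infty$ and let $\ell^p=\ell^p(\mathbb{Z}_+)$ be the space of $p$-summable sequences $x=(x_0,x_1,x_2,\dots)$ of real or complex scalars. For a bounded sequence $w=(w_n)_{n\ge 1}$ of non-zero scalars, the weighted shift $B_w:\ell^p\to\ell^p$ is the bounded operator $B_w(x_0,x_1,x_2,\dots)=(w_1x_1,w_2x_2,w_3x_3,\dots)$. The lower density of $A\subset\mathbb{Z}_+$ is $\underline{\mathrm{dens}}\,A=\liminf_{N\to\infty}\frac{\#(A\cap[0,N])}{N+1}$. A vector $x$ is frequently hypercyclic for a bounded operator $T$ on a Banach space $X$ if $\underline{\mathrm{dens}}\{n\ge 0: T^nx\in U\}>0$ for every non-empty open set $U\subset X$; $T$ is frequently hypercyclic if it has a frequently hypercyclic vector; a frequently hypercyclic subspace for $T$ is an infinite-dimensional closed subspace of $X$ in which every non-zero vector is frequently hypercyclic for $T$. Given an increasing (not necessarily strictly) sequence $(a_n)_{n\ge 1}$ of positive integers, let $$w=(4,1^{a_1},4,1^{a_2},4,1^{a_3},4,1^{a_4},4,\dots),$$ where $1^{a_n}$ designates a block of ones of length $a_n$. Then: 1. $B_w$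 is frequently hypercyclic on $\ell^p$ if and only if $$\sum_{k=1}^{\infty}\frac{a_k}{(4^k)^p}<\infty. \qquad (\ast)$$ 2. If $(\ast)$ holds and $$\liminf_{n\to\infty}\frac{a_n-\sum_{k=1}^{n-1}a_k-n}{\sum_{k=1}^{n}a_k+(n+1)}>0,$$ then $B_w$ has a frequently hypercyclic subspace. 3. In particular, if $a_n=3^{n-1}$ for all $n\ge 1$, then $B_w$ is frequently hypercyclic on $\ell^p$ and has a frequently hypercyclic subspace. -/

import Mathlib

open scoped ENNReal

/-- The lower density `liminf_N #(A ∩ [0, N]) / (N + 1)` of a set of non-negative integers. -/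
noncomputable def lowerDensity (A : Set ℕ) : ℝ :=
  Filter.liminf (fun N : ℕ => ((A ∩ Set.Iic N).ncard : ℝ) / ((N : ℝ) + 1)) Filter.atTop

section FrequentHypercyclicity

variable {𝕜 X : Type*} [RCLike 𝕜] [NormedAddCommGroup X] [NormedSpace 𝕜 X]

/-- `x` is a frequently hypercyclic vector for `T`: its orbit visits every non-empty open set
along a set of times of positive lower density. -/
def IsFrequentlyHypercyclicVector (T : X →L[𝕜] X) (x : X) : Prop :=
  ∀ U : Set X, IsOpen U → U.Nonempty → 0 < lowerDensity {n : ℕ | (T ^ n) x ∈ U}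

/-- `T` is frequently hypercyclic: it has a frequently hypercyclic vector. -/
def IsFrequentlyHypercyclic (T : X →L[𝕜] X) : Prop :=
  ∃ x : X, IsFrequentlyHypercyclicVector T x

/-- `T` has a frequently hypercyclic subspace: an infinite-dimensional closed subspace all of
whose non-zero vectors are frequently hypercyclic for `T`. -/
def HasFrequentlyHypercyclicSubspace (T : X →L[𝕜] X) : Prop :=
  ∃ M : Submodule 𝕜 X, IsClosed (M : Set X) ∧ ¬ FiniteDimensional 𝕜 M ∧
    ∀ x ∈ M, x ≠ 0 → IsFrequentlyHypercyclicVector T x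

end FrequentHypercyclicity

section WeightedShift

variable {𝕜 : Type*} [RCLike 𝕜]

theorem memℓp_weightedShift (p : ℝ≥0∞) [Fact (1 ≤ p)] (w : ℕ → 𝕜) {C : ℝ}
    (hw : ∀ n, 1 ≤ n → ‖w n‖ ≤ C) (x : lp (fun _ : ℕ => 𝕜) p) :
    Memℓp (fun n : ℕ => w (n + 1) * x (n + 1)) p := by
  have hx : Memℓp (fun n : ℕ => x (n + 1)) p := by
    rcases eq_or_ne p ∞ with rfl | hp
    · refine memℓp_infty ⟨‖x‖, ?_⟩
      rintro _ ⟨n, rfl⟩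
      exact lp.norm_apply_le_norm ENNReal.top_ne_zero x (n + 1)
    · have h0 : 0 < p.toReal :=
        ENNReal.toReal_pos (zero_lt_one.trans_le (Fact.out : 1 ≤ p)).ne' hp
      exact memℓp_gen (((lp.memℓp x).summable h0).comp_injective (add_left_injective 1))
  have h2 : 0 ≤ C := (norm_nonneg _).trans (hw 1 le_rfl)
  refine (hx.const_mul (C : 𝕜)).mono' fun n => ?_
  rw [norm_mul, norm_mul, RCLike.norm_ofReal, abs_of_nonneg h2]
  exact mul_le_mul_of_nonneg_right (hw (n + 1) (Nat.le_add_left 1 n)) (norm_nonneg _)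

/-- The weighted shift `B_w (x₀, x₁, x₂, …) = (w₁ x₁, w₂ x₂, w₃ x₃, …)` on `ℓ^p`, for a sequence
`w = (w_n)_{n ≥ 1}` bounded by `C`; the value `w 0` plays no role. -/
noncomputable def weightedShift (p : ℝ≥0∞) [Fact (1 ≤ p)] (w : ℕ → 𝕜) {C : ℝ}
    (hw : ∀ n, 1 ≤ n → ‖w n‖ ≤ C) :
    lp (fun _ : ℕ => 𝕜) p →L[𝕜] lp (fun _ : ℕ => 𝕜) p :=
  LinearMap.mkContinuous
    { toFun := fun x => ⟨fun n : ℕ => w (n + 1) * x (n + 1), memℓp_weightedShift p w hw x⟩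
      map_add' := fun x y => by
        ext n
        exact mul_add _ _ _
      map_smul' := fun c x => by
        ext n
        exact mul_left_comm _ _ _ }
    C
    (fun x => by
      have hC : 0 ≤ C := (norm_nonneg _).trans (hw 1 le_rfl)
      have hle : ∀ n : ℕ, ‖w (n + 1) * x (n + 1)‖ ≤ C * ‖x (n + 1)‖ := fun n => by
        rw [norm_mul]
        exact mul_le_mul_of_nonneg_right (hw (n + 1) (Nat.le_add_left 1 n)) (norm_nonneg _)
      rcases eq_or_ne p ∞ with rfl | hp
      · refine lp.norm_le_of_forall_le (by positivity) fun n => (hle n).trans ?_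
        exact mul_le_mul_of_nonneg_left (lp.norm_apply_le_norm ENNReal.top_ne_zero x (n + 1)) hC
      · have h0 : 0 < p.toReal :=
          ENNReal.toReal_pos (zero_lt_one.trans_le (Fact.out : 1 ≤ p)).ne' hp
        refine lp.norm_le_of_forall_sum_le h0 (by positivity) fun s => ?_
        calc ∑ n ∈ s, ‖w (n + 1) * x (n + 1)‖ ^ p.toReal
            ≤ ∑ n ∈ s, C ^ p.toReal * ‖x (n + 1)‖ ^ p.toReal := by
              refine Finset.sum_le_sum fun n _ => ?_
              rw [← Real.mul_rpow hC (norm_nonneg _)]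
              exact Real.rpow_le_rpow (norm_nonneg _) (hle n) h0.le
          _ = C ^ p.toReal * ∑ m ∈ s.map (addRightEmbedding 1), ‖x m‖ ^ p.toReal := by
              rw [Finset.mul_sum, Finset.sum_map]
              simp
          _ ≤ C ^ p.toReal * ‖x‖ ^ p.toReal :=
              mul_le_mul_of_nonneg_left (lp.sum_rpow_le_norm_rpow h0 x _)
                (Real.rpow_nonneg hC _)
          _ = (C * ‖x‖) ^ p.toReal := (Real.mul_rpow hC (norm_nonneg _)).symm)

end WeightedShift

/-- The weight sequence `w = (4, 1^{a₁}, 4, 1^{a₂}, 4, 1^{a₃}, 4, …)`, indexed by `k ≥ 1`, where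
`1^m` is a block of `m` ones: for `n ≥ 1`, the `n`-th `4` stands at the place
`k = a₁ + ⋯ + a_{n-1} + n`. -/
noncomputable def blockWeight (𝕜 : Type*) [RCLike 𝕜] (a : ℕ → ℕ) (k : ℕ) : 𝕜 :=
  open Classical in
  if ∃ n : ℕ, 1 ≤ n ∧ k = (∑ j ∈ Finset.Ico 1 n, a j) + n then 4 else 1

theorem norm_blockWeight_le (𝕜 : Type*) [RCLike 𝕜] (a : ℕ → ℕ) (k : ℕ) (_ : 1 ≤ k) :
    ‖blockWeight 𝕜 a k‖ ≤ 4 := by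
  unfold blockWeight
  split_ifs
  · simp
  · simp

/-- The weighted shift `B_w` on `ℓ^p` with `w = (4, 1^{a₁}, 4, 1^{a₂}, 4, 1^{a₃}, 4, …)`. -/
noncomputable def blockShift (𝕜 : Type*) [RCLike 𝕜] (p : ℝ≥0∞) [Fact (1 ≤ p)] (a : ℕ → ℕ) :
    lp (fun _ : ℕ => 𝕜) p →L[𝕜] lp (fun _ : ℕ => 𝕜) p :=
  weightedShift p (blockWeight 𝕜 a) (norm_blockWeight_le 𝕜 a)

/-! ### Lower density and summability along sets of positive lower density. -/

section LowerDensity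

/-! Write P_n = w_1 ⋯ w_n. For these weights |P_n| is non-decreasing, and frequent hypercyclicity is
equivalent to ∑ |P_n|^(-p) < ∞. Since |P_n| = 4^k for exactly a_k + 1 indices, this is condition
(∗). Necessity (`summable_of_isFrequentlyHypercyclic`): visits near e_0 bound |P_n|^(-p) by a
multiple of |x_n|^p along a set of positive lower density, and monotonicity extends the convergence
to all n. Sufficiency (`exists_frequently_hitting_family`): copies of a dense sequence of finite
vectors, divided by P_k, are placed on well separated blocks whose starting points have positive
lower density. For the subspace, let m_i be the ends of sparsely chosen long blocks of ones. On
e_{m_i} the power B_w^j is harmless unless it pushes m_i out of its plateau, and the remaining times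
j contain long intervals. The subspace is the range of E + Y on ℓ^p, where E is an isometry into the
closed span of the e_{m_i} and ‖Y‖ ≤ 1/2. The summand Y c makes the orbit visit every ball along
good times, while B_w^j (E c) tends to 0 along them
(`hasFrequentlyHypercyclicSubspace_of_longIntervals`). -/

theorem ncard_inter_Iic_le (A : Set ℕ) (N : ℕ) : (A ∩ Set.Iic N).ncard ≤ N + 1 := by
  calc (A ∩ Set.Iic N).ncard ≤ (Set.Iic N).ncard :=
        Set.ncard_le_ncard Set.inter_subset_right (Set.finite_Iic N)
    _ = N + 1 := by rw [← Finset.coe_Iic, Set.ncard_coe_finset, Nat.card_Iic]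

theorem lowerDensity_pos_of_eventually_le {A : Set ℕ} {δ : ℝ} (hδ : 0 < δ)
    (h : ∀ᶠ N : ℕ in Filter.atTop, δ * ((N : ℝ) + 1) ≤ ((A ∩ Set.Iic N).ncard : ℝ)) :
    0 < lowerDensity A := by
  refine hδ.trans_le (Filter.le_liminf_of_le ?_ ?_)
  · refine Filter.IsBoundedUnder.isCoboundedUnder_ge ⟨1, ?_⟩
    refine Filter.eventually_map.2 (Filter.Eventually.of_forall fun N => ?_)
    refine div_le_one_of_le₀ ?_ (by positivity)
    exact_mod_cast ncard_inter_Iic_le A N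
  · filter_upwards [h] with N hN
    rwa [le_div_iff₀ (by positivity)]

theorem exists_pos_eventually_le_of_liminf_pos {u : ℕ → ℝ}
    (h : 0 < Filter.liminf u Filter.atTop) :
    ∃ δ > 0, ∀ᶠ N in Filter.atTop, δ ≤ u N := by
  rw [Filter.liminf_eq] at h
  -- A real `liminf` defaults to 0 when there is no eventual lower bound, so positivity excludes
  -- this case.
  have hne : {a | ∀ᶠ n in Filter.atTop, a ≤ u n}.Nonempty := by
    by_contra hne
    rw [Set.not_nonempty_iff_eq_empty.1 hne, Real.sSup_empty] at h
    exact lt_irrefl _ h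
  obtain ⟨δ, hδ, h0⟩ := exists_lt_of_lt_csSup hne h
  exact ⟨δ, h0, hδ⟩

theorem exists_pos_eventually_le_of_lowerDensity_pos {A : Set ℕ} (h : 0 < lowerDensity A) :
    ∃ δ > 0, ∀ᶠ N : ℕ in Filter.atTop, δ * ((N : ℝ) + 1) ≤ ((A ∩ Set.Iic N).ncard : ℝ) := by
  obtain ⟨δ, hδ, hA⟩ := exists_pos_eventually_le_of_liminf_pos h
  refine ⟨δ, hδ, hA.mono fun N hN => ?_⟩
  rwa [le_div_iff₀ (by positivity)] at hN

open Classical in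
/-- An antitone sequence which is summable along a set of positive lower density is summable. -/
theorem summable_of_antitone_of_summable_indicator {f : ℕ → ℝ} (hf0 : ∀ n, 0 ≤ f n)
    (hf : Antitone f) {A : Set ℕ} (hA : 0 < lowerDensity A)
    (hs : Summable (A.indicator f)) : Summable f := by
  obtain ⟨δ, hδ, hA⟩ := exists_pos_eventually_le_of_lowerDensity_pos hA
  obtain ⟨N₁, hN₁⟩ := Filter.eventually_atTop.1 hA
  have hi : ∀ n, 0 ≤ A.indicator f n := fun n => Set.indicator_nonneg (fun n _ => hf0 n) n
  -- Excess of the counting function of A over δN, shifted by δN₁ to be non-negative everywhere.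
  -- Abel summation against the antitone f then bounds δ ∑ f by ∑_A f plus D 0 * f 0.
  let D : ℕ → ℝ := fun N =>
    (((Finset.range N).filter (· ∈ A)).card : ℝ) - δ * N + δ * N₁
  have hD0 : ∀ N, 0 ≤ D N := by
    intro N
    rcases le_or_gt N N₁ with h | h
    · have : (N : ℝ) ≤ N₁ := by exact_mod_cast h
      have h1 := mul_le_mul_of_nonneg_left this hδ.le
      have h2 : (0 : ℝ) ≤ (((Finset.range N).filter (· ∈ A)).card : ℝ) := by positivity
      simp only [D]
      linarith
    · obtain ⟨n, rfl⟩ : ∃ n, N = n + 1 := ⟨N - 1, by omega⟩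
      have h1 := hN₁ n (by omega)
      have h2 : A ∩ Set.Iic n = (((Finset.range (n + 1)).filter (· ∈ A) : Finset ℕ) : Set ℕ) := by
        ext k
        simp [and_comm]
      rw [h2, Set.ncard_coe_finset] at h1
      have h3 : 0 ≤ δ * N₁ := by positivity
      simp only [D]
      push_cast
      linarith
  have hDs : ∀ N, (D (N + 1) - D N) * f N = A.indicator f N - δ * f N := by
    intro N
    simp only [D, Finset.range_add_one, Finset.filter_insert]
    by_cases h : N ∈ A
    · simp [h]
      ring
    · simp [h]
      ring
  have key : ∀ N, D N * f N - D 0 * f 0 ≤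
      ∑ n ∈ Finset.range N, (A.indicator f n - δ * f n) := by
    intro N
    induction N with
    | zero => simp
    | succ N ih =>
      rw [Finset.sum_range_succ, ← hDs]
      have := mul_le_mul_of_nonneg_left (hf (Nat.le_succ N)) (hD0 (N + 1))
      linarith
  refine summable_of_sum_range_le (c := (∑' n, A.indicator f n + D 0 * f 0) / δ) hf0 fun N => ?_
  rw [le_div_iff₀ hδ]
  have h1 := key N
  rw [Finset.sum_sub_distrib, ← Finset.mul_sum] at h1
  have h2 := hs.sum_le_tsum (Finset.range N) (fun n _ => hi n)
  have h3 := mul_nonneg (hD0 N) (hf0 N)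
  linarith

end LowerDensity

/-- A convergent series of positive terms still converges after multiplication by some monotone
sequence tending to infinity. -/
theorem exists_monotone_tendsto_atTop_summable_mul {f : ℕ → ℝ} (hf : ∀ n, 0 < f n)
    (hs : Summable f) :
    ∃ θ : ℕ → ℝ, (∀ n, 0 ≤ θ n) ∧ Monotone θ ∧ Filter.Tendsto θ Filter.atTop Filter.atTop ∧
      Summable fun n => θ n * f n := by
  let R : ℕ → ℝ := fun k => ∑' n, f (n + k)
  have hsk : ∀ k, Summable fun n => f (n + k) := fun k => (summable_nat_add_iff k).2 hs
  have hR : ∀ k, R k = f k + R (k + 1) := by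
    intro k
    simp only [R]
    rw [(hsk k).tsum_eq_zero_add]
    simp [add_assoc, add_comm 1 k]
  have hRpos : ∀ k, 0 < R k := fun k => (hsk k).tsum_pos (fun n => (hf _).le) 0 (hf _)
  have hanti : Antitone R := antitone_nat_of_succ_le fun k => by
    rw [hR k]
    linarith [hf k]
  have hlim : Filter.Tendsto R Filter.atTop (nhds 0) := tendsto_sum_nat_add f
  -- With R the tails of the series, f_k / √R_k ≤ 2(√R_k − √R_{k+1}), which telescopes.
  refine ⟨fun k => (√(R k))⁻¹, fun n => by positivity, ?_, ?_, ?_⟩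
  · intro i j hij
    exact inv_anti₀ (Real.sqrt_pos.2 (hRpos j)) (Real.sqrt_le_sqrt (hanti hij))
  · refine Filter.Tendsto.inv_tendsto_nhdsGT_zero (tendsto_nhdsWithin_iff.2 ⟨?_, ?_⟩)
    · have := (Real.continuous_sqrt.tendsto 0).comp hlim
      rwa [Real.sqrt_zero] at this
    · exact Filter.Eventually.of_forall fun k => Real.sqrt_pos.2 (hRpos k)
  · have hle : ∀ k, (√(R k))⁻¹ * f k ≤ 2 * (√(R k) - √(R (k + 1))) := by
      intro k
      have h1 := Real.sqrt_pos.2 (hRpos k)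
      have h2 := Real.sqrt_pos.2 (hRpos (k + 1))
      have h3 := Real.sq_sqrt (hRpos k).le
      have h4 := Real.sq_sqrt (hRpos (k + 1)).le
      have h5 := Real.sqrt_le_sqrt (hanti (Nat.le_succ k))
      have h6 := hR k
      rw [inv_mul_le_iff₀ h1]
      have h7 : f k = (√(R k) - √(R (k + 1))) * (√(R k) + √(R (k + 1))) := by
        linear_combination h4 - h3 - h6
      rw [h7]
      nlinarith
    refine summable_of_sum_range_le (c := 2 * √(R 0))
      (fun n => mul_nonneg (by positivity) (hf n).le) fun N => ?_
    calc ∑ k ∈ Finset.range N, (√(R k))⁻¹ * f k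
        ≤ ∑ k ∈ Finset.range N, 2 * (√(R k) - √(R (k + 1))) :=
          Finset.sum_le_sum fun k _ => hle k
      _ = 2 * (√(R 0) - √(R N)) := by
          rw [← Finset.mul_sum, Finset.sum_range_sub']
      _ ≤ 2 * √(R 0) := by
          have := Real.sqrt_nonneg (R N)
          linarith

/-! ### Mutually separated sets of positive lower density. -/

section SeparatedSets

/-- `spacing K N ν = ∏_{i ≤ ν} K N_i`. -/
def spacing (K : ℕ) (N : ℕ → ℕ) (ν : ℕ) : ℕ := ∏ i ∈ Finset.range (ν + 1), K * N i

/-- The positive multiples of `spacing K N ν` which stay away from the positive multiples of the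
later spacings. -/
def separatedSet (K : ℕ) (N : ℕ → ℕ) (ν : ℕ) : Set ℕ :=
  {n | 0 < n ∧ spacing K N ν ∣ n ∧ ∀ μ, ν < μ → ∀ s, 0 < s →
    n + N μ ≤ s * spacing K N μ ∨ s * spacing K N μ + N μ ≤ n}

variable {K : ℕ} {N : ℕ → ℕ}

theorem spacing_succ (ν : ℕ) : spacing K N (ν + 1) = spacing K N ν * (K * N (ν + 1)) :=
  Finset.prod_range_succ _ _

theorem spacing_pos (hK : 2 ≤ K) (hN : ∀ ν, 0 < N ν) (ν : ℕ) : 0 < spacing K N ν :=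
  Finset.prod_pos fun i _ => Nat.mul_pos (by omega) (hN i)

theorem two_mul_le_spacing (hK : 2 ≤ K) (hN : ∀ ν, 0 < N ν) (ν : ℕ) :
    2 * N ν ≤ spacing K N ν := by
  have h1 : 2 * N ν ≤ K * N ν := Nat.mul_le_mul_right _ hK
  refine h1.trans ?_
  cases ν with
  | zero => simp [spacing]
  | succ ν =>
    rw [spacing_succ]
    exact Nat.le_mul_of_pos_left _ (spacing_pos hK hN ν)

theorem two_mul_spacing_le (hK : 2 ≤ K) (hN : ∀ ν, 0 < N ν) (ν : ℕ) :
    2 * spacing K N ν ≤ spacing K N (ν + 1) := by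
  rw [spacing_succ, mul_comm 2]
  refine Nat.mul_le_mul_left _ ?_
  have := hN (ν + 1)
  nlinarith

theorem le_of_mem_separatedSet (hK : 2 ≤ K) (hN : ∀ ν, 0 < N ν) {ν n : ℕ}
    (hn : n ∈ separatedSet K N ν) : N ν ≤ n := by
  have := two_mul_le_spacing hK hN ν
  have := Nat.le_of_dvd hn.1 hn.2.1
  omega

/-- For different indices, the point with the larger index is a multiple of its spacing, which the
other set avoids by definition. For equal indices, distinct multiples differ by at least 2 * N ν. -/
theorem separatedSet_separated (hK : 2 ≤ K) (hN : ∀ ν, 0 < N ν) (hmono : Monotone N)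
    {ν μ n m : ℕ} (hn : n ∈ separatedSet K N ν) (hm : m ∈ separatedSet K N μ) :
    (n = m ∧ ν = μ) ∨ (n + N ν ≤ m ∧ n + N μ ≤ m) ∨ (m + N ν ≤ n ∧ m + N μ ≤ n) := by
  have aux : ∀ {ν μ n m : ℕ}, n ∈ separatedSet K N ν → m ∈ separatedSet K N μ → ν < μ →
      (n + N ν ≤ m ∧ n + N μ ≤ m) ∨ (m + N ν ≤ n ∧ m + N μ ≤ n) := by
    intro ν μ n m hn hm h
    obtain ⟨s, rfl⟩ := hm.2.1
    have hs : 0 < s := Nat.pos_of_mul_pos_left hm.1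
    have h1 := hn.2.2 μ h s hs
    rw [mul_comm s] at h1
    have h2 := hmono h.le
    omega
  rcases lt_trichotomy ν μ with h | rfl | h
  · exact Or.inr (aux hn hm h)
  · have h0 := two_mul_le_spacing hK hN ν
    obtain ⟨s, rfl⟩ := hn.2.1
    obtain ⟨t, rfl⟩ := hm.2.1
    have h1 : ∀ s t : ℕ, s < t → spacing K N ν * s + N ν ≤ spacing K N ν * t := by
      intro s t hst
      have := Nat.mul_le_mul_left (spacing K N ν) hst
      rw [Nat.mul_succ] at this
      omega
    rcases lt_trichotomy s t with hst | rfl | hst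
    · exact Or.inr (Or.inl ⟨h1 s t hst, h1 s t hst⟩)
    · exact Or.inl ⟨rfl, rfl⟩
    · exact Or.inr (Or.inr ⟨h1 t s hst, h1 t s hst⟩)
  · have := aux hm hn h
    omega

theorem sum_inv_spacing_le (hK : 2 ≤ K) (hN : ∀ ν, 0 < N ν) (ν L : ℕ) :
    ∑ i ∈ Finset.range L, ((spacing K N (ν + i) : ℝ))⁻¹ ≤ 2 * (spacing K N ν : ℝ)⁻¹ := by
  have hle : ∀ i, ((spacing K N (ν + i) : ℝ))⁻¹ ≤ (spacing K N ν : ℝ)⁻¹ * (1 / 2) ^ i := by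
    intro i
    induction i with
    | zero => simp
    | succ i ih =>
      have h1 : (2 : ℝ) * spacing K N (ν + i) ≤ spacing K N (ν + (i + 1)) := by
        exact_mod_cast two_mul_spacing_le hK hN (ν + i)
      have h2 : (0 : ℝ) < spacing K N (ν + i) := by exact_mod_cast spacing_pos hK hN _
      calc ((spacing K N (ν + (i + 1)) : ℝ))⁻¹ ≤ (2 * (spacing K N (ν + i) : ℝ))⁻¹ :=
            inv_anti₀ (by positivity) h1
        _ = (spacing K N (ν + i) : ℝ)⁻¹ * (1 / 2) := by rw [mul_inv]; ring
        _ ≤ _ := by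
            rw [pow_succ, ← mul_assoc]
            exact mul_le_mul_of_nonneg_right ih (by norm_num)
  calc _ ≤ ∑ i ∈ Finset.range L, (spacing K N ν : ℝ)⁻¹ * (1 / 2) ^ i :=
        Finset.sum_le_sum fun i _ => hle i
    _ = (spacing K N ν : ℝ)⁻¹ * ∑ i ∈ Finset.range L, (1 / 2 : ℝ) ^ i := by rw [Finset.mul_sum]
    _ ≤ (spacing K N ν : ℝ)⁻¹ * 2 :=
        mul_le_mul_of_nonneg_left (sum_geometric_two_le L) (by positivity)
    _ = _ := mul_comm _ _

-- Write M_μ for the spacings. Among the multiples of M_ν, those lost to a later μ lie within N_μ of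
-- one of at most 2v / M_μ multiples of M_μ, hence number at most 4vN_μ / M_μ = 4v / (K M_{μ-1}). As
-- the spacings at least double, the total loss is at most 8v / (K M_ν): the factor K makes it a
-- small proportion, uniformly in ν.
open Classical in
theorem card_separatedSet_ge (hK : 2 ≤ K) (hN : ∀ ν, 0 < N ν) (ν u v : ℕ) :
    ((v : ℝ) - u) / spacing K N ν - 1 - 8 / K * v / spacing K N ν ≤
      (((Finset.Ioc u v).filter (· ∈ separatedSet K N ν)).card : ℝ) := by
  set M := spacing K N with hM
  have hMpos : ∀ μ, 0 < M μ := spacing_pos hK hN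
  have hMR : ∀ μ, (0 : ℝ) < M μ := fun μ => by exact_mod_cast hMpos μ
  -- the elements removed because of `μ = ν + 1 + i`
  let E : ℕ → Finset ℕ := fun i => (Finset.Ioc 0 (2 * v / M (ν + 1 + i))).biUnion fun s =>
    Finset.Ico (s * M (ν + 1 + i) + 1 - N (ν + 1 + i)) (s * M (ν + 1 + i) + N (ν + 1 + i))
  have hE : ∀ i, ((E i).card : ℝ) ≤ 4 / K * v * (M (ν + i) : ℝ)⁻¹ := by
    intro i
    have h1 : (E i).card ≤ (2 * v / M (ν + 1 + i)) * (2 * N (ν + 1 + i)) := by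
      refine (Finset.card_biUnion_le_card_mul _ _ (2 * N (ν + 1 + i)) fun s _ => ?_).trans ?_
      · rw [Nat.card_Ico]
        omega
      · rw [Nat.card_Ioc, Nat.sub_zero]
    have h2 : ((2 * v / M (ν + 1 + i) : ℕ) : ℝ) ≤ 2 * v / M (ν + 1 + i) := by
      have := @Nat.cast_div_le ℝ _ _ _ (2 * v) (M (ν + 1 + i))
      push_cast at this
      exact this
    have h3 : (M (ν + 1 + i) : ℝ) = M (ν + i) * (K * N (ν + 1 + i)) := by
      have := @spacing_succ K N (ν + i)
      rw [show ν + i + 1 = ν + 1 + i by ring] at this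
      rw [hM, this]
      push_cast
      ring
    have h4 : (0 : ℝ) < N (ν + 1 + i) := by exact_mod_cast hN _
    have h5 : (0 : ℝ) < K := by exact_mod_cast (by omega : 0 < K)
    calc ((E i).card : ℝ) ≤ (2 * v / M (ν + 1 + i) : ℕ) * (2 * N (ν + 1 + i)) := by
          exact_mod_cast h1
      _ ≤ (2 * v / M (ν + 1 + i)) * (2 * N (ν + 1 + i)) :=
          mul_le_mul_of_nonneg_right h2 (by positivity)
      _ = _ := by
          rw [h3]
          have := hMR (ν + i)
          field_simp
          ring
  have hsub : (Finset.Ioc u v).filter (M ν ∣ ·) ⊆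
      (Finset.Ioc u v).filter (· ∈ separatedSet K N ν) ∪ (Finset.range v).biUnion E := by
    intro n hn
    rw [Finset.mem_filter, Finset.mem_Ioc] at hn
    obtain ⟨⟨hn1, hn2⟩, hn3⟩ := hn
    by_cases h : n ∈ separatedSet K N ν
    · exact Finset.mem_union_left _ (by simp [h, hn1, hn2])
    · refine Finset.mem_union_right _ ?_
      have h' : ∃ μ, ν < μ ∧ ∃ s, 0 < s ∧ s * M μ < n + N μ ∧ n < s * M μ + N μ := by
        by_contra hcon
        push Not at hcon
        refine h ⟨by omega, hn3, fun μ hμ s hs => ?_⟩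
        by_contra h2
        push Not at h2
        have := hcon μ hμ s hs h2.1
        exact absurd h2.2 (by simpa using this)
      obtain ⟨μ, hμ, s, hs, h1, h2⟩ := h'
      obtain ⟨i, rfl⟩ : ∃ i, μ = ν + 1 + i := ⟨μ - (ν + 1), by omega⟩
      -- Since N_μ ≤ sM_μ / 2, closeness of n to sM_μ forces sM_μ < 2n ≤ 2v. This bounds s, and also
      -- i because M_μ ≥ 2M_{μ-1} > 2(μ - 1).
      have h3 : 2 * N (ν + 1 + i) ≤ M (ν + 1 + i) := two_mul_le_spacing hK hN _
      have h4 : M (ν + 1 + i) ≤ s * M (ν + 1 + i) := Nat.le_mul_of_pos_left _ hs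
      have h5 : ∀ j, j < M j := by
        intro j
        induction j with
        | zero => exact hMpos 0
        | succ j ih =>
          have : 2 * M j ≤ M (j + 1) := two_mul_spacing_le hK hN j
          omega
      have h6 := h5 (ν + i)
      have h7 : 2 * M (ν + i) ≤ M (ν + 1 + i) := by
        have : 2 * M (ν + i) ≤ M (ν + i + 1) := two_mul_spacing_le hK hN (ν + i)
        rwa [show ν + i + 1 = ν + 1 + i by ring] at this
      refine Finset.mem_biUnion.2 ⟨i, Finset.mem_range.2 (by omega), ?_⟩
      refine Finset.mem_biUnion.2 ⟨s, Finset.mem_Ioc.2 ⟨hs, ?_⟩, Finset.mem_Ico.2 ⟨by omega, h2⟩⟩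
      rw [Nat.le_div_iff_mul_le (hMpos _)]
      omega
  have hcard := (Finset.card_le_card hsub).trans (Finset.card_union_le _ _)
  have hrem : (((Finset.range v).biUnion E).card : ℝ) ≤ 8 / K * v / M ν := by
    calc (((Finset.range v).biUnion E).card : ℝ) ≤ ∑ i ∈ Finset.range v, ((E i).card : ℝ) := by
          exact_mod_cast Finset.card_biUnion_le
      _ ≤ ∑ i ∈ Finset.range v, 4 / K * v * (M (ν + i) : ℝ)⁻¹ :=
          Finset.sum_le_sum fun i _ => hE i
      _ = 4 / K * v * ∑ i ∈ Finset.range v, (M (ν + i) : ℝ)⁻¹ := by rw [Finset.mul_sum]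
      _ ≤ 4 / K * v * (2 * (M ν : ℝ)⁻¹) :=
          mul_le_mul_of_nonneg_left (sum_inv_spacing_le hK hN ν v) (by positivity)
      _ = _ := by ring
  have hmul : ((v : ℝ) - u) / M ν - 1 ≤ (((Finset.Ioc u v).filter (M ν ∣ ·)).card : ℝ) := by
    have h2 : v / M ν ≤ ((Finset.Ioc u v).filter (M ν ∣ ·)).card + u / M ν := by
      have h3 : ((Finset.Ioc 0 v).filter (M ν ∣ ·)) ⊆
          ((Finset.Ioc u v).filter (M ν ∣ ·)) ∪ ((Finset.Ioc 0 u).filter (M ν ∣ ·)) := by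
        intro n
        simp only [Finset.mem_filter, Finset.mem_union, Finset.mem_Ioc]
        rintro ⟨⟨h4, h5⟩, h6⟩
        by_cases h7 : u < n
        · exact Or.inl ⟨⟨h7, h5⟩, h6⟩
        · exact Or.inr ⟨⟨h4, by omega⟩, h6⟩
      have h8 := (Finset.card_le_card h3).trans (Finset.card_union_le _ _)
      rwa [Nat.Ioc_filter_dvd_card_eq_div, Nat.Ioc_filter_dvd_card_eq_div] at h8
    have h3 : (v : ℝ) / M ν - 1 ≤ (v / M ν : ℕ) := by
      rw [← Nat.floor_div_eq_div (K := ℝ)]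
      exact (Nat.sub_one_lt_floor _).le
    have h4 : ((u / M ν : ℕ) : ℝ) ≤ u / M ν := Nat.cast_div_le
    have h5 : ((v / M ν : ℕ) : ℝ) ≤
        ((Finset.Ioc u v).filter (M ν ∣ ·)).card + (u / M ν : ℕ) := by exact_mod_cast h2
    rw [sub_div]
    linarith
  have h1 : ((((Finset.Ioc u v).filter (M ν ∣ ·)).card : ℕ) : ℝ) ≤
      (((Finset.Ioc u v).filter (· ∈ separatedSet K N ν)).card : ℝ) +
        (((Finset.range v).biUnion E).card : ℝ) := by exact_mod_cast hcard
  linarith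

/-- `G` contains, for all large `N`, an interval inside `[0, N]` of length at least `κ N`. -/
def ContainsLongIntervals (κ : ℝ) (G : Set ℕ) : Prop :=
  ∀ᶠ N : ℕ in Filter.atTop, ∃ u v : ℕ, u ≤ v ∧ v ≤ N ∧ Set.Ioc u v ⊆ G ∧ κ * N ≤ (v : ℝ) - u

theorem lowerDensity_separatedSet_inter_pos (hK : 2 ≤ K) (hN : ∀ ν, 0 < N ν) {κ : ℝ} (hκ : 0 < κ)
    (hKκ : 16 / κ ≤ K) {G : Set ℕ} (hG : ContainsLongIntervals κ G) (ν J : ℕ) {A : Set ℕ}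
    (hA : ∀ j ∈ separatedSet K N ν, j ∈ G → J ≤ j → j ∈ A) :
    0 < lowerDensity A := by
  classical
  have hM : (0 : ℝ) < spacing K N ν := by exact_mod_cast spacing_pos hK hN ν
  have hK0 : (0 : ℝ) < K := by exact_mod_cast (by omega : 0 < K)
  set M : ℝ := (spacing K N ν : ℝ)
  -- An interval of length κn yields κn / M points; K ≥ 16 / κ limits the loss to half of them, and
  -- half of the rest absorbs the constants 1 + J.
  refine lowerDensity_pos_of_eventually_le (δ := κ / (4 * M)) (by positivity) ?_
  have hlarge : ∀ᶠ n : ℕ in Filter.atTop, (1 + J + κ / (4 * M)) * (4 * M / κ) ≤ (n : ℝ) :=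
    tendsto_natCast_atTop_atTop.eventually_ge_atTop _
  filter_upwards [hG, hlarge] with n hn hl
  obtain ⟨u, v, huv, hvn, hsub, hlen⟩ := hn
  have h1 := card_separatedSet_ge hK hN ν u v
  have hfin : (A ∩ Set.Iic n).Finite := (Set.finite_Iic n).subset Set.inter_subset_right
  have h2 : (Finset.Ioc u v).filter (· ∈ separatedSet K N ν) ⊆
      hfin.toFinset ∪ Finset.range J := by
    intro j hj
    rw [Finset.mem_filter, Finset.mem_Ioc] at hj
    rw [Finset.mem_union, Set.Finite.mem_toFinset, Finset.mem_range]
    by_cases hJ : J ≤ j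
    · exact Or.inl ⟨hA j hj.2 (hsub hj.1) hJ, by simp; omega⟩
    · exact Or.inr (by omega)
  have h3 := (Finset.card_le_card h2).trans (Finset.card_union_le _ _)
  rw [← Set.ncard_eq_toFinset_card _ hfin, Finset.card_range] at h3
  have h4 : (((Finset.Ioc u v).filter (· ∈ separatedSet K N ν)).card : ℝ) ≤
      ((A ∩ Set.Iic n).ncard : ℝ) + J := by exact_mod_cast h3
  have h5 : 8 / K * v ≤ κ / 2 * n := by
    have h6 : 8 / (K : ℝ) ≤ κ / 2 := by
      rw [div_le_iff₀ hκ] at hKκ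
      rw [div_le_iff₀ hK0]
      linarith
    have h7 : (v : ℝ) ≤ n := by exact_mod_cast hvn
    exact mul_le_mul h6 h7 (by positivity) (by positivity)
  have h6 : κ / 2 * n / M ≤ ((v : ℝ) - u) / M - 8 / K * v / M := by
    rw [← sub_div]
    exact div_le_div_of_nonneg_right (by linarith) hM.le
  have h8 : 1 + J + κ / (4 * M) ≤ n * (κ / (4 * M)) := by
    have := mul_le_mul_of_nonneg_right hl (by positivity : 0 ≤ κ / (4 * M))
    rwa [mul_assoc, div_mul_div_comm, mul_comm (4 * M) κ, div_self (by positivity), mul_one] at this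
  have h9 : κ / 2 * n / M = 2 * (n * (κ / (4 * M))) := by
    field_simp
    ring
  have h10 : κ / (4 * M) * ((n : ℝ) + 1) = n * (κ / (4 * M)) + κ / (4 * M) := by ring
  linarith

end SeparatedSets

theorem IsFrequentlyHypercyclicVector.lowerDensity_norm_sub_lt {𝕜 X : Type*} [RCLike 𝕜]
    [NormedAddCommGroup X] [NormedSpace 𝕜 X] {T : X →L[𝕜] X} {x : X}
    (h : IsFrequentlyHypercyclicVector T x) (u : X) {ε : ℝ} (hε : 0 < ε) :
    0 < lowerDensity {n : ℕ | ‖(T ^ n) x - u‖ < ε} := by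
  have := h (Metric.ball u ε) Metric.isOpen_ball ⟨u, Metric.mem_ball_self hε⟩
  simpa only [Metric.mem_ball, dist_eq_norm] using this

theorem isFrequentlyHypercyclicVector_of_lowerDensity_norm_sub_lt {𝕜 X : Type*} [RCLike 𝕜]
    [NormedAddCommGroup X] [NormedSpace 𝕜 X] {T : X →L[𝕜] X} {x : X}
    (h : ∀ (u : X) (ε : ℝ), 0 < ε → ∃ A ⊆ {n : ℕ | ‖(T ^ n) x - u‖ < ε}, 0 < lowerDensity A) :
    IsFrequentlyHypercyclicVector T x := by
  rintro U hU ⟨u, hu⟩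
  obtain ⟨ε, hε, hsub⟩ := Metric.isOpen_iff.1 hU u hu
  obtain ⟨A, hA, hd⟩ := h u ε hε
  obtain ⟨δ, hδ, hev⟩ := exists_pos_eventually_le_of_lowerDensity_pos hd
  refine lowerDensity_pos_of_eventually_le hδ (hev.mono fun N hN => hN.trans ?_)
  refine Nat.cast_le.2 (Set.ncard_le_ncard ?_ ((Set.finite_Iic N).subset Set.inter_subset_right))
  refine Set.inter_subset_inter_left _ fun n hn => hsub ?_
  rw [Metric.mem_ball, dist_eq_norm]
  exact hA hn

/-! ### Weighted shifts: weight products and the necessary condition. -/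

section WeightedShiftTheory

variable {𝕜 : Type*} [RCLike 𝕜]

/-- The product `w₁ ⋯ w_n`. -/
def weightProd (w : ℕ → 𝕜) (n : ℕ) : 𝕜 := ∏ i ∈ Finset.range n, w (i + 1)

theorem weightProd_succ (w : ℕ → 𝕜) (n : ℕ) : weightProd w (n + 1) = weightProd w n * w (n + 1) :=
  Finset.prod_range_succ _ _

@[simp]
theorem weightProd_zero (w : ℕ → 𝕜) : weightProd w 0 = 1 := rfl

theorem weightProd_ne_zero {w : ℕ → 𝕜} (hw : ∀ n, w (n + 1) ≠ 0) (n : ℕ) : weightProd w n ≠ 0 :=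
  Finset.prod_ne_zero_iff.2 fun i _ => hw i

variable {p : ℝ≥0∞} [Fact (1 ≤ p)]

theorem toReal_pos_of_one_le (hp : p ≠ ∞) : 0 < p.toReal :=
  ENNReal.toReal_pos (zero_lt_one.trans_le (Fact.out : 1 ≤ p)).ne' hp

theorem weightedShift_apply (w : ℕ → 𝕜) {C : ℝ} (hw : ∀ n, 1 ≤ n → ‖w n‖ ≤ C)
    (x : lp (fun _ : ℕ => 𝕜) p) (k : ℕ) : weightedShift p w hw x k = w (k + 1) * x (k + 1) := rfl

/-- Division-free form of (B_w^j x)_k = (P_{k+j} / P_k) x_{k+j}. -/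
theorem weightProd_mul_weightedShift_pow_apply (w : ℕ → 𝕜) {C : ℝ} (hw : ∀ n, 1 ≤ n → ‖w n‖ ≤ C)
    (j : ℕ) (x : lp (fun _ : ℕ => 𝕜) p) (k : ℕ) :
    weightProd w k * (weightedShift p w hw ^ j) x k = weightProd w (k + j) * x (k + j) := by
  induction j generalizing x with
  | zero => rfl
  | succ j ih =>
    rw [pow_succ, mul_apply_eq_comp, ih, weightedShift_apply, ← mul_assoc,
      ← weightProd_succ, add_assoc]

/-- If the weighted shift is frequently hypercyclic and the weight products have non-decreasing
moduli, then `∑ 1 / ‖w₁ ⋯ w_n‖ ^ p` converges. -/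
theorem summable_of_isFrequentlyHypercyclic (hp : p ≠ ∞) {w : ℕ → 𝕜} {C : ℝ}
    (hw : ∀ n, 1 ≤ n → ‖w n‖ ≤ C) (hw0 : ∀ n, w (n + 1) ≠ 0)
    (hmono : Monotone fun n => ‖weightProd w n‖)
    (h : IsFrequentlyHypercyclic (weightedShift p w hw)) :
    Summable fun n => ‖weightProd w n‖⁻¹ ^ p.toReal := by
  have hq := toReal_pos_of_one_le hp
  obtain ⟨x, hx⟩ := h
  have hP : ∀ n, 0 < ‖weightProd w n‖ := fun n => norm_pos_iff.2 (weightProd_ne_zero hw0 n)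
  obtain ⟨e, he⟩ : ∃ e : lp (fun _ : ℕ => 𝕜) p, e 0 = 1 :=
    ⟨lp.single p 0 1, lp.single_apply_self (E := fun _ : ℕ => 𝕜) p 0 1⟩
  -- Within 1/2 of e_0, coordinate 0 gives ‖P_n x_n‖ ≥ 1/2, hence ‖P_n‖^(-p) ≤ 2^p ‖x_n‖^p.
  have hA := hx.lowerDensity_norm_sub_lt e (ε := 1 / 2) (by norm_num)
  refine summable_of_antitone_of_summable_indicator (fun n => by positivity) ?_ hA ?_
  · intro i j hij
    exact Real.rpow_le_rpow (by positivity) (inv_anti₀ (hP i) (hmono hij)) hq.le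
  · have hs : Summable fun n => 2 ^ p.toReal * ‖x n‖ ^ p.toReal :=
      ((lp.memℓp x).summable hq).mul_left _
    refine Summable.of_nonneg_of_le (fun n => Set.indicator_nonneg (fun n _ => ?_) n)
      (fun n => Set.indicator_apply_le' (fun hn => ?_) fun _ => ?_) hs
    · positivity
    swap
    · positivity
    rw [← Real.mul_rpow (by norm_num) (norm_nonneg _)]
    refine Real.rpow_le_rpow (by positivity) ?_ hq.le
    rw [inv_le_iff_one_le_mul₀ (hP n)]
    rw [Set.mem_ofPred_eq] at hn
    have h1 := (lp.norm_apply_le_norm (zero_lt_one.trans_le (Fact.out : 1 ≤ p)).ne'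
      ((weightedShift p w hw ^ n) x - e) 0).trans_lt hn
    have h2 := weightProd_mul_weightedShift_pow_apply w hw n x 0
    rw [weightProd_zero, one_mul, zero_add] at h2
    rw [lp.coeFn_sub, Pi.sub_apply, h2, he] at h1
    have h3 := norm_sub_norm_le (1 : 𝕜) (weightProd w n * x n)
    rw [norm_sub_rev, norm_one, norm_mul] at h3
    linarith

variable (𝕜 p) in
theorem exists_denseRange_finite_support (hp : p ≠ ∞) :
    ∃ z : ℕ → lp (fun _ : ℕ => 𝕜) p, DenseRange z ∧ ∀ l, ∃ d, ∀ k, d ≤ k → z l k = 0 := by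
  have hp0 : 0 < p := zero_lt_one.trans_le Fact.out
  let D : ℕ → 𝕜 := TopologicalSpace.denseSeq 𝕜
  let Z : (Σ d : ℕ, Fin d → ℕ) → lp (fun _ : ℕ => 𝕜) p :=
    fun s => ∑ i : Fin s.1, lp.single p (i : ℕ) (D (s.2 i))
  have : Nonempty (Σ d : ℕ, Fin d → ℕ) := ⟨⟨0, fun _ => 0⟩⟩
  obtain ⟨φ, hφ⟩ := exists_surjective_nat (Σ d : ℕ, Fin d → ℕ)
  refine ⟨fun l => Z (φ l), ?_, fun l => ⟨(φ l).1, fun k hk => ?_⟩⟩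
  · refine Metric.denseRange_iff.2 fun x ε hε => ?_
    obtain ⟨d, hd⟩ := ((Metric.tendsto_nhds.1 (lp.hasSum_single hp x).tendsto_sum_nat)
      (ε / 2) (by positivity)).exists
    have hD : ∀ i, ∃ l, dist (x i) (D l) < ε / (2 * (d + 1)) := fun i =>
      Metric.denseRange_iff.1 (TopologicalSpace.denseRange_denseSeq 𝕜) _ _ (by positivity)
    choose l hl using hD
    obtain ⟨n, hn⟩ := hφ ⟨d, fun i => l i⟩
    refine ⟨n, (dist_triangle_left _ _ _).trans_lt (add_lt_add_of_lt_of_le hd ?_ |>.trans_eq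
      (add_halves ε))⟩
    simp only [hn, Z]
    rw [Finset.sum_range, dist_eq_norm, ← Finset.sum_sub_distrib]
    calc _ ≤ ∑ i : Fin d, ε / (2 * (d + 1)) := norm_sum_le_of_le _ fun i _ => by
          rw [← lp.single_sub, lp.norm_single hp0, ← dist_eq_norm]
          exact (hl i).le
      _ = d * (ε / (2 * (d + 1))) := by simp
      _ ≤ ε / 2 := by
          rw [mul_div_assoc', div_le_div_iff₀ (by positivity) (by positivity)]
          nlinarith
  · simp only [Z]
    rw [lp.coeFn_sum, Finset.sum_apply]
    refine Finset.sum_eq_zero fun i _ => lp.single_apply_ne _ _ _ ?_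
    have := i.2
    omega

end WeightedShiftTheory

/-! ### Construction of frequently hypercyclic vectors and subspaces. -/

section Construction

variable {𝕜 : Type*} [RCLike 𝕜] {p : ℝ≥0∞} [Fact (1 ≤ p)]

theorem lp_norm_le_of_tail_le (hp : p ≠ ∞) {v : lp (fun _ : ℕ => 𝕜) p} {g : ℕ → ℝ}
    (hg : Summable g) (N : ℕ) (hz : ∀ k, k < N → v k = 0)
    (hle : ∀ k, N ≤ k → ‖v k‖ ^ p.toReal ≤ g k) {C : ℝ} (hC : 0 ≤ C)
    (h : ∑' k, g (k + N) ≤ C ^ p.toReal) : ‖v‖ ≤ C := by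
  have hq := toReal_pos_of_one_le hp
  have hv : Summable fun k => ‖v k‖ ^ p.toReal := (lp.memℓp v).summable hq
  refine lp.norm_le_of_tsum_le hq hC ?_
  rw [← hv.sum_add_tsum_nat_add N, Finset.sum_eq_zero, zero_add]
  · refine le_trans (Summable.tsum_le_tsum (fun k => hle (k + N) (Nat.le_add_left _ _)) ?_ ?_) h
    · exact (summable_nat_add_iff N).2 hv
    · exact (summable_nat_add_iff N).2 hg
  · intro k hk
    rw [hz k (Finset.mem_range.1 hk), norm_zero, Real.zero_rpow hq.ne']

/-- Copies of the patterns `t ν` are placed on the disjoint blocks `[n, n + N ν)`, where `n` runs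
through a separated set attached to `ν`; `ρ` records the label `r ν` of the block. -/
theorem exists_pattern {K : ℕ} {N : ℕ → ℕ} (hK : 2 ≤ K) (hN : ∀ ν, 0 < N ν) (hmono : Monotone N)
    (t : ℕ → ℕ → 𝕜) (r : ℕ → ℕ) :
    ∃ (T : ℕ → 𝕜) (ρ : ℕ → ℕ),
      (∀ ν, ∀ n ∈ separatedSet K N ν, ∀ i, i < N ν → T (n + i) = t ν i ∧ ρ (n + i) = r ν) ∧
      ∀ k, T k ≠ 0 → ∃ ν, ∃ n ∈ separatedSet K N ν, n ≤ k ∧ k < n + N ν ∧ T k = t ν (k - n) := by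
  have h : ∀ k, ∃ (x : 𝕜) (s : ℕ),
      (∀ ν, ∀ n ∈ separatedSet K N ν, n ≤ k → k < n + N ν → x = t ν (k - n) ∧ s = r ν) ∧
      (x ≠ 0 → ∃ ν, ∃ n ∈ separatedSet K N ν, n ≤ k ∧ k < n + N ν ∧ x = t ν (k - n)) := by
    intro k
    by_cases hk : ∃ ν, ∃ n ∈ separatedSet K N ν, n ≤ k ∧ k < n + N ν
    · obtain ⟨ν, n, hn, h1, h2⟩ := hk
      refine ⟨t ν (k - n), r ν, fun μ m hm h3 h4 => ?_, fun _ => ⟨ν, n, hn, h1, h2, rfl⟩⟩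
      rcases separatedSet_separated hK hN hmono hn hm with ⟨rfl, rfl⟩ | h | h
      · exact ⟨rfl, rfl⟩
      · omega
      · omega
    · exact ⟨0, 0, fun ν n hn h1 h2 => absurd ⟨ν, n, hn, h1, h2⟩ hk, fun h => absurd rfl h⟩
  choose T ρ h1 h2 using h
  refine ⟨T, ρ, fun ν n hn i hi => ?_, h2⟩
  have := h1 (n + i) ν n hn (by omega) (by omega)
  rwa [Nat.add_sub_cancel_left] at this

/-- One pattern serves all coefficient sequences c: blocks labelled r carry the factor c r, so a
single non-zero c r suffices to approximate every u. The multiplier θ leaves room for unbounded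
patterns: block ν starts beyond N ν, where θ already dominates its entries, and ∑ θ f still
converges. -/
theorem exists_frequently_hitting_family (hp : p ≠ ∞) {w : ℕ → 𝕜} {C : ℝ}
    (hw : ∀ n, 1 ≤ n → ‖w n‖ ≤ C) (hw0 : ∀ n, w (n + 1) ≠ 0)
    (hs : Summable fun n => ‖weightProd w n‖⁻¹ ^ p.toReal) {κ : ℝ} (hκ : 0 < κ) :
    ∃ (T : ℕ → 𝕜) (ρ : ℕ → ℕ),
      (∀ (c : ℕ → 𝕜) (D : ℝ), (∀ i, ‖c i‖ ≤ D) →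
        ∃ h : Memℓp (fun k => c (ρ k) * T k) p,
          ‖(⟨fun k => c (ρ k) * T k, h⟩ : lp (fun _ : ℕ => 𝕜) p)‖ ≤ D / 2) ∧
      ∀ (c : ℕ → 𝕜) (D : ℝ), (∀ i, ‖c i‖ ≤ D) → ∀ y : lp (fun _ : ℕ => 𝕜) p,
        (∀ k, y k = c (ρ k) * T k) → ∀ r, c r ≠ 0 → ∀ G, ContainsLongIntervals κ G →
        ∀ (J : ℕ) (u : lp (fun _ : ℕ => 𝕜) p) (ε : ℝ), 0 < ε →
          0 < lowerDensity {j | j ∈ G ∧ J ≤ j ∧ ‖(weightedShift p w hw ^ j) y - u‖ < ε} := by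
  have hq := toReal_pos_of_one_le hp
  have hP0 := weightProd_ne_zero hw0
  have hP : ∀ n, 0 < ‖weightProd w n‖ := fun n => norm_pos_iff.2 (hP0 n)
  set f : ℕ → ℝ := fun n => ‖weightProd w n‖⁻¹ ^ p.toReal with hf
  have hfpos : ∀ n, 0 < f n := fun n => Real.rpow_pos_of_pos (inv_pos.2 (hP n)) _
  obtain ⟨θ, hθ0, hθmono, hθtop, hθs⟩ := exists_monotone_tendsto_atTop_summable_mul hfpos hs
  have htail := tendsto_sum_nat_add fun n => θ n * f n
  obtain ⟨z, hz, hzd⟩ := exists_denseRange_finite_support 𝕜 p hp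
  choose d hd using hzd
  -- The index ν encodes a label, a target, and a spare number that lets N ν be arbitrarily large
  -- for the same label and target.
  let r : ℕ → ℕ := fun ν => ν.unpair.1
  let l : ℕ → ℕ := fun ν => ν.unpair.2.unpair.1
  let t : ℕ → ℕ → 𝕜 := fun ν i => weightProd w i * z (l ν) i
  have hev : ∀ ν, ∀ᶠ N in Filter.atTop, 1 ≤ N ∧ d (l ν) ≤ N ∧
      (∀ i, ‖t ν i‖ ^ p.toReal ≤ θ N) ∧ ∑' k, θ (k + N) * f (k + N) ≤ (1 / 2) ^ p.toReal := by
    intro ν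
    have h1 : ∀ᶠ N in Filter.atTop,
        ∑ i ∈ Finset.range (d (l ν)), ‖t ν i‖ ^ p.toReal ≤ θ N := hθtop.eventually_ge_atTop _
    have h2 := htail.eventually_le_const (u := (1 / 2 : ℝ) ^ p.toReal) (by positivity)
    filter_upwards [Filter.eventually_ge_atTop 1, Filter.eventually_ge_atTop (d (l ν)), h1, h2]
      with N hN1 hN2 hN3 hN4
    refine ⟨hN1, hN2, fun i => ?_, hN4⟩
    by_cases hi : i < d (l ν)
    · exact (Finset.single_le_sum (f := fun i => ‖t ν i‖ ^ p.toReal)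
        (fun i _ => by positivity) (Finset.mem_range.2 hi)).trans hN3
    · have : t ν i = 0 := by simp only [t, hd (l ν) i (by omega), mul_zero]
      rw [this, norm_zero, Real.zero_rpow hq.ne']
      exact hθ0 N
  obtain ⟨N, hNmono, hN⟩ := Filter.extraction_forall_of_eventually hev
  obtain ⟨K, hK⟩ := exists_nat_ge (max 2 (16 / κ))
  have hK2 : 2 ≤ K := by exact_mod_cast (le_max_left _ _).trans hK
  have hKκ : 16 / κ ≤ K := (le_max_right _ _).trans hK
  have hNpos : ∀ ν, 0 < N ν := fun ν => (hN ν).1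
  obtain ⟨T, ρ, hT, hTsupp⟩ := exists_pattern hK2 hNpos hNmono.monotone t r
  have hbound : ∀ k, ‖T k‖ ^ p.toReal ≤ θ k := by
    intro k
    by_cases h0 : T k = 0
    · rw [h0, norm_zero, Real.zero_rpow hq.ne']
      exact hθ0 k
    · obtain ⟨ν, n, hn, h1, -, h3⟩ := hTsupp k h0
      rw [h3]
      exact ((hN ν).2.2.1 _).trans (hθmono ((le_of_mem_separatedSet hK2 hNpos hn).trans h1))
  -- After the shift by j, a block of index μ to the right of j still starts at or beyond N μ, so
  -- the bound by θ survives.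
  have hbound' : ∀ ν, ∀ j ∈ separatedSet K N ν, ∀ k, N ν ≤ k → ‖T (k + j)‖ ^ p.toReal ≤ θ k := by
    intro ν j hj k hk
    by_cases h0 : T (k + j) = 0
    · rw [h0, norm_zero, Real.zero_rpow hq.ne']
      exact hθ0 k
    · obtain ⟨μ, n, hn, h1, h2, h3⟩ := hTsupp _ h0
      rw [h3]
      refine ((hN μ).2.2.1 _).trans (hθmono ?_)
      rcases separatedSet_separated hK2 hNpos hNmono.monotone hj hn with ⟨rfl, rfl⟩ | h | h <;>
      omega
  have hzero : ∀ k, k < N 0 → T k = 0 := by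
    intro k hk
    by_contra h0
    obtain ⟨ν, n, hn, h1, -, -⟩ := hTsupp k h0
    have h2 := le_of_mem_separatedSet hK2 hNpos hn
    have h3 := hNmono.monotone (Nat.zero_le ν)
    omega
  have hcoord : ∀ (c : ℕ → 𝕜) (D : ℝ), (∀ i, ‖c i‖ ≤ D) → ∀ i k j,
      ‖T j‖ ^ p.toReal ≤ θ k →
      ‖c i * (T j / weightProd w k)‖ ^ p.toReal ≤ D ^ p.toReal * (θ k * f k) := by
    intro c D hc i k j hj
    have hD : 0 ≤ D := (norm_nonneg _).trans (hc i)
    rw [norm_mul, norm_div, div_eq_mul_inv, Real.mul_rpow (norm_nonneg _) (by positivity),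
      Real.mul_rpow (norm_nonneg _) (by positivity)]
    have h1 : ‖c i‖ ^ p.toReal ≤ D ^ p.toReal := Real.rpow_le_rpow (norm_nonneg _) (hc i) hq.le
    have h2 : ‖T j‖ ^ p.toReal * ‖weightProd w k‖⁻¹ ^ p.toReal ≤ θ k * f k :=
      mul_le_mul_of_nonneg_right hj (hfpos k).le
    exact mul_le_mul h1 h2 (by positivity) (by positivity)
  refine ⟨fun k => T k / weightProd w k, ρ, fun c D hc => ?_, ?_⟩
  · have hD : 0 ≤ D := (norm_nonneg _).trans (hc 0)
    have hle := fun k => hcoord c D hc (ρ k) k k (hbound k)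
    have hsum := hθs.mul_left (D ^ p.toReal)
    refine ⟨memℓp_gen (hsum.of_nonneg_of_le (fun k => by positivity) hle), ?_⟩
    refine lp_norm_le_of_tail_le hp hsum (N 0) (fun k hk => ?_) (fun k _ => hle k)
      (by positivity) ?_
    · change c (ρ k) * (T k / weightProd w k) = 0
      rw [hzero k hk, zero_div, mul_zero]
    · rw [tsum_mul_left, div_eq_mul_one_div D 2, Real.mul_rpow hD (by norm_num)]
      exact mul_le_mul_of_nonneg_left (hN 0).2.2.2 (by positivity)
  · intro c D hc y hy s hs0 G hG J u ε hε
    have hD : 0 ≤ D := (norm_nonneg _).trans (hc 0)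
    have hcs : 0 < ‖c s‖ := norm_pos_iff.2 hs0
    -- The block is multiplied by c s, so the pattern must approximate (c s)⁻¹ u.
    obtain ⟨l₀, hl₀⟩ := Metric.denseRange_iff.1 hz ((c s)⁻¹ • u) (ε / 2 / ‖c s‖) (by positivity)
    have hzu : ‖c s • z l₀ - u‖ < ε / 2 := by
      rw [dist_comm, dist_eq_norm, lt_div_iff₀ hcs, mul_comm, ← norm_smul, smul_sub,
        smul_inv_smul₀ hs0] at hl₀
      exact hl₀
    have hsum := hθs.mul_left (D ^ p.toReal)
    have hsmall : ∀ᶠ n in Filter.atTop,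
        ∑' k, D ^ p.toReal * (θ (k + n) * f (k + n)) ≤ (ε / 2) ^ p.toReal :=
      (tendsto_sum_nat_add fun n => D ^ p.toReal * (θ n * f n)).eventually_le_const
        (by positivity)
    obtain ⟨n₀, hn₀⟩ := Filter.eventually_atTop.1 hsmall
    let ν := Nat.pair s (Nat.pair l₀ n₀)
    have hrν : r ν = s := by simp [r, ν]
    have hlν : l ν = l₀ := by simp [l, ν]
    have hνN : n₀ ≤ N ν :=
      ((Nat.right_le_pair l₀ n₀).trans (Nat.right_le_pair s _)).trans (hNmono.id_le ν)
    refine lowerDensity_separatedSet_inter_pos hK2 hNpos hκ hKκ hG ν J fun j hj hjG hJ =>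
      ⟨hjG, hJ, ?_⟩
    have happ : ∀ k, (weightedShift p w hw ^ j) y k =
        c (ρ (k + j)) * (T (k + j) / weightProd w k) := by
      intro k
      have h1 := weightProd_mul_weightedShift_pow_apply w hw j y k
      rw [hy] at h1
      have h2 := hP0 k
      have h3 := hP0 (k + j)
      field_simp at h1 ⊢
      linear_combination h1
    have hclose : ‖(weightedShift p w hw ^ j) y - c s • z l₀‖ ≤ ε / 2 := by
      refine lp_norm_le_of_tail_le hp hsum (N ν) (fun k hk => ?_) (fun k hk => ?_)
        (by positivity) (hn₀ _ hνN)
      · obtain ⟨h1, h2⟩ := hT ν j hj k hk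
        rw [lp.coeFn_sub, Pi.sub_apply, lp.coeFn_smul, Pi.smul_apply, happ, add_comm k j, h1, h2,
          hrν, smul_eq_mul, sub_eq_zero]
        simp only [t, hlν]
        rw [mul_div_cancel_left₀ _ (hP0 k)]
      · have h1 : z l₀ k = 0 := hd l₀ k (by
          rw [← hlν]
          exact (hN ν).2.1.trans hk)
        rw [lp.coeFn_sub, Pi.sub_apply, lp.coeFn_smul, Pi.smul_apply, h1, smul_zero, sub_zero,
          happ]
        exact hcoord c D hc _ k _ (hbound' ν j hj k hk)
    calc ‖(weightedShift p w hw ^ j) y - u‖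
        ≤ ‖(weightedShift p w hw ^ j) y - c s • z l₀‖ + ‖c s • z l₀ - u‖ :=
          norm_sub_le_norm_sub_add_norm_sub _ _ _
      _ < ε := by linarith

theorem isFrequentlyHypercyclic_of_summable (hp : p ≠ ∞) {w : ℕ → 𝕜} {C : ℝ}
    (hw : ∀ n, 1 ≤ n → ‖w n‖ ≤ C) (hw0 : ∀ n, w (n + 1) ≠ 0)
    (hs : Summable fun n => ‖weightProd w n‖⁻¹ ^ p.toReal) :
    IsFrequentlyHypercyclic (weightedShift p w hw) := by
  obtain ⟨T, ρ, h1, h2⟩ := exists_frequently_hitting_family hp hw hw0 hs one_pos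
  obtain ⟨hy, -⟩ := h1 (fun _ => 1) 1 (fun _ => by simp)
  refine ⟨⟨_, hy⟩, isFrequentlyHypercyclicVector_of_lowerDensity_norm_sub_lt fun u ε hε =>
    ⟨_, fun j hj => hj.2.2, h2 (fun _ => 1) 1 (fun _ => by simp) ⟨_, hy⟩ (fun _ => rfl) 0
      one_ne_zero Set.univ ?_ 0 u ε hε⟩⟩
  exact Filter.Eventually.of_forall fun N =>
    ⟨0, N, Nat.zero_le _, le_rfl, Set.subset_univ _, by simp⟩

/-- The isometric embedding of `ℓ^p` which moves the coordinate `i` to the coordinate `m i`. -/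
theorem exists_extend_isometry (hp : p ≠ ∞) {m : ℕ → ℕ} (hm : Function.Injective m) :
    ∃ E : lp (fun _ : ℕ => 𝕜) p →ₗ[𝕜] lp (fun _ : ℕ => 𝕜) p, (∀ c, ‖E c‖ = ‖c‖) ∧
      ∀ c k, k ∉ Set.range m → E c k = 0 := by
  have hq := toReal_pos_of_one_le hp
  have hnorm : ∀ (c : ℕ → 𝕜), (fun k => ‖Function.extend m c 0 k‖ ^ p.toReal) =
      Function.extend m (fun i => ‖c i‖ ^ p.toReal) 0 := by
    intro c
    ext k
    by_cases hk : ∃ i, m i = k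
    · obtain ⟨i, rfl⟩ := hk
      rw [hm.extend_apply, hm.extend_apply]
    · rw [Function.extend_apply' _ _ _ hk, Function.extend_apply' _ _ _ hk]
      simp [Real.zero_rpow hq.ne']
  have hmem : ∀ c : lp (fun _ : ℕ => 𝕜) p, Memℓp (Function.extend m c 0) p := by
    intro c
    refine memℓp_gen ?_
    rw [hnorm c, summable_extend_zero hm]
    exact (lp.memℓp c).summable hq
  refine ⟨{ toFun := fun c => ⟨Function.extend m c 0, hmem c⟩, map_add' := ?_, map_smul' := ?_ },
    ?_, ?_⟩
  · intro c c'
    ext k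
    change Function.extend m (⇑c + ⇑c') 0 k =
      Function.extend m c 0 k + Function.extend m c' 0 k
    by_cases hk : ∃ i, m i = k
    · obtain ⟨i, rfl⟩ := hk
      simp only [hm.extend_apply, Pi.add_apply]
    · simp [Function.extend_apply' _ _ _ hk]
  · intro a c
    ext k
    by_cases hk : ∃ i, m i = k
    · obtain ⟨i, rfl⟩ := hk
      simp [hm.extend_apply]
    · simp [Function.extend_apply' _ _ _ hk]
  · intro c
    refine (Real.rpow_left_inj (norm_nonneg _) (norm_nonneg _) hq.ne').1 ?_
    rw [lp.norm_rpow_eq_tsum hq, lp.norm_rpow_eq_tsum hq]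
    change ∑' k, ‖Function.extend m c 0 k‖ ^ p.toReal = _
    rw [hnorm c, tsum_extend_zero hm]
  · intro c k hk
    exact Function.extend_apply' _ _ _ hk

theorem not_finiteDimensional_lp (𝕜 : Type*) [RCLike 𝕜] (p : ℝ≥0∞) :
    ¬ FiniteDimensional 𝕜 (lp (fun _ : ℕ => 𝕜) p) := by
  intro h
  have hli : LinearIndependent 𝕜 fun i : ℕ => (lp.single p i (1 : 𝕜) : lp (fun _ : ℕ => 𝕜) p) := by
    rw [linearIndependent_iff']
    intro s g hg i hi
    have := congrArg (fun v : lp (fun _ : ℕ => 𝕜) p => v i) hg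
    simp only [lp.coeFn_sum, Finset.sum_apply, lp.coeFn_smul, Pi.smul_apply, smul_eq_mul] at this
    rw [Finset.sum_eq_single i] at this
    · rw [lp.single_apply_self, mul_one] at this
      exact this
    · intro j _ hj
      rw [lp.single_apply_ne _ _ _ hj.symm, mul_zero]
    · exact fun h => absurd hi h
  have := hli.finite
  exact not_finite ℕ

/-- For j in G each coordinate of B_w^j v is at most C₀ ‖v_{k+j}‖, so the norm is at most C₀ times a
tail of v. -/
theorem tendsto_weightedShift_pow_of_supported (hp : p ≠ ∞) {w : ℕ → 𝕜} {C : ℝ}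
    (hw : ∀ n, 1 ≤ n → ‖w n‖ ≤ C) (hw0 : ∀ n, w (n + 1) ≠ 0) {S G : Set ℕ} {C₀ : ℝ}
    (hC₀ : 0 ≤ C₀)
    (hG : ∀ j ∈ G, ∀ m ∈ S, j ≤ m → ‖weightProd w m‖ ≤ C₀ * ‖weightProd w (m - j)‖)
    {v : lp (fun _ : ℕ => 𝕜) p} (hv : ∀ k, k ∉ S → v k = 0) {ε : ℝ} (hε : 0 < ε) :
    ∃ J, ∀ j ∈ G, J ≤ j → ‖(weightedShift p w hw ^ j) v‖ ≤ ε := by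
  have hq := toReal_pos_of_one_le hp
  have hP : ∀ n, 0 < ‖weightProd w n‖ := fun n => norm_pos_iff.2 (weightProd_ne_zero hw0 n)
  have hsum : Summable fun k => C₀ ^ p.toReal * ‖v k‖ ^ p.toReal :=
    ((lp.memℓp v).summable hq).mul_left _
  obtain ⟨J, hJ⟩ := Filter.eventually_atTop.1 ((tendsto_sum_nat_add fun k =>
    C₀ ^ p.toReal * ‖v k‖ ^ p.toReal).eventually_le_const
      (u := ε ^ p.toReal) (by positivity))
  refine ⟨J, fun j hj hJj => ?_⟩
  refine lp_norm_le_of_tail_le hp (g := fun k => C₀ ^ p.toReal * ‖v (k + j)‖ ^ p.toReal)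
    ((summable_nat_add_iff j).2 hsum) 0 (fun k hk => absurd hk (Nat.not_lt_zero k))
    (fun k _ => ?_) hε.le (hJ j hJj)
  rw [← Real.mul_rpow hC₀ (norm_nonneg _)]
  refine Real.rpow_le_rpow (norm_nonneg _) ?_ hq.le
  have h1 := congrArg norm (weightProd_mul_weightedShift_pow_apply w hw j v k)
  rw [norm_mul, norm_mul] at h1
  by_cases hk : k + j ∈ S
  · have h2 := hG j hj _ hk (Nat.le_add_left _ _)
    rw [Nat.add_sub_cancel] at h2
    refine le_of_mul_le_mul_left ?_ (hP k)
    rw [h1]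
    calc _ ≤ (C₀ * ‖weightProd w k‖) * ‖v (k + j)‖ :=
          mul_le_mul_of_nonneg_right h2 (norm_nonneg _)
      _ = _ := by ring
  · rw [hv _ hk, norm_zero, mul_zero] at h1 ⊢
    rcases mul_eq_zero.1 h1 with h3 | h3
    · exact absurd h3 (hP k).ne'
    · exact h3.le

/-- If the powers `B_w ^ j`, for `j` in a set containing long intervals, are uniformly bounded on
infinitely many unit vectors, then a frequently hypercyclic `B_w` has a frequently hypercyclic
subspace. -/
theorem hasFrequentlyHypercyclicSubspace_of_longIntervals (hp : p ≠ ∞) {w : ℕ → 𝕜} {C : ℝ}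
    (hw : ∀ n, 1 ≤ n → ‖w n‖ ≤ C) (hw0 : ∀ n, w (n + 1) ≠ 0)
    (hs : Summable fun n => ‖weightProd w n‖⁻¹ ^ p.toReal) {κ : ℝ} (hκ : 0 < κ) {G : Set ℕ}
    (hG : ContainsLongIntervals κ G) {m : ℕ → ℕ} (hm : Function.Injective m) {C₀ : ℝ}
    (hC₀ : 0 ≤ C₀)
    (hmG : ∀ j ∈ G, ∀ i, j ≤ m i → ‖weightProd w (m i)‖ ≤ C₀ * ‖weightProd w (m i - j)‖) :
    HasFrequentlyHypercyclicSubspace (weightedShift p w hw) := by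
  obtain ⟨T, ρ, h1, h2⟩ := exists_frequently_hitting_family hp hw hw0 hs hκ
  obtain ⟨E, hE, hE0⟩ := exists_extend_isometry (𝕜 := 𝕜) hp hm
  have hp0 : p ≠ 0 := (zero_lt_one.trans_le (Fact.out : 1 ≤ p)).ne'
  have hc : ∀ (c : lp (fun _ : ℕ => 𝕜) p) i, ‖c i‖ ≤ ‖c‖ := fun c i =>
    lp.norm_apply_le_norm hp0 c i
  let Y : lp (fun _ : ℕ => 𝕜) p →ₗ[𝕜] lp (fun _ : ℕ => 𝕜) p :=
    { toFun := fun c => ⟨fun k => c (ρ k) * T k, (h1 c ‖c‖ (hc c)).1⟩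
      map_add' := fun c c' => by
        ext k
        exact add_mul _ _ _
      map_smul' := fun a c => by
        ext k
        exact mul_assoc _ _ _ }
  have hY : ∀ c, ‖Y c‖ ≤ ‖c‖ / 2 := fun c => (h1 c ‖c‖ (hc c)).2
  -- As E is isometric and ‖Y‖ ≤ 1/2, E + Y is bounded below; hence its range is closed and
  -- infinite-dimensional.
  have hbelow : ∀ c, ‖c‖ ≤ 2 * ‖(E + Y) c‖ := by
    intro c
    have h3 := norm_sub_le ((E + Y) c) (Y c)
    rw [LinearMap.add_apply, add_sub_cancel_right, hE] at h3
    have h4 := hY c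
    rw [LinearMap.add_apply]
    linarith
  have hbound : ∀ c, ‖(E + Y) c‖ ≤ 2 * ‖c‖ := by
    intro c
    have h3 := norm_add_le (E c) (Y c)
    rw [hE] at h3
    have h4 := hY c
    have h5 := norm_nonneg c
    rw [LinearMap.add_apply]
    linarith
  let Φ := (E + Y).mkContinuous 2 hbound
  have hanti : AntilipschitzWith 2 Φ := AddMonoidHomClass.antilipschitz_of_bound Φ hbelow
  refine ⟨LinearMap.range Φ.toLinearMap, ?_, ?_, ?_⟩
  · have := hanti.isClosed_range Φ.uniformContinuous
    rwa [LinearMap.coe_range]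
  · intro hfin
    refine not_finiteDimensional_lp 𝕜 p ?_
    exact Module.Finite.of_injective (LinearMap.rangeRestrict Φ.toLinearMap) fun x y hxy =>
      hanti.injective (Subtype.ext_iff.1 hxy)
  · rintro _ ⟨c, rfl⟩ hx
    have hc0 : ∃ s, c s ≠ 0 := by
      by_contra! hcon
      refine hx ?_
      have : c = 0 := by
        ext s
        exact hcon s
      rw [this, map_zero]
    obtain ⟨s, hs0⟩ := hc0
    refine isFrequentlyHypercyclicVector_of_lowerDensity_norm_sub_lt fun u ε hε => ?_
    obtain ⟨J, hJ⟩ := tendsto_weightedShift_pow_of_supported hp hw hw0 (S := Set.range m) hC₀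
      (fun j hj _ ⟨i, hi⟩ hji => by
        subst hi
        exact hmG j hj i hji)
      (hE0 c) (half_pos hε)
    refine ⟨_, fun j hj => ?_, h2 c ‖c‖ (hc c) (Y c) (fun _ => rfl) s hs0 G hG J u (ε / 2)
      (half_pos hε)⟩
    obtain ⟨hjG, hjJ, hj⟩ := hj
    have h3 := hJ j hjG hjJ
    change ‖(weightedShift p w hw ^ j) (E c + Y c) - u‖ < ε
    rw [map_add, add_sub_assoc]
    exact (norm_add_le _ _).trans_lt (by linarith)

end Construction

/-! ### Good times containing long intervals. -/

section LongIntervals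

theorem containsLongIntervals_of_gaps {m b : ℕ → ℕ} {δ : ℝ} (hδ : 0 < δ)
    (hbm : ∀ k, b k ≤ m k) (hδm : ∀ k, δ * m k ≤ b k) (hmb : ∀ k, 2 * m k < b (k + 1)) :
    ContainsLongIntervals (δ / 4) {j | ∀ i, j ≤ m i → j ≤ b i} := by
  have hm : StrictMono m := strictMono_nat_of_lt_succ fun k => by
    have := hmb k
    have := hbm (k + 1)
    omega
  have hb : Monotone b := monotone_nat_of_le_succ fun k => by
    have := hmb k
    have := hbm k
    omega
  have hδ1 : δ ≤ 1 := by
    have h1 : (0 : ℝ) < m 1 := by exact_mod_cast (Nat.zero_le _).trans_lt (hm one_pos)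
    have h2 : (b 1 : ℝ) ≤ m 1 := by exact_mod_cast hbm 1
    have h3 := hδm 1
    by_contra! h
    nlinarith
  have hsub : ∀ k v, v ≤ b (k + 1) → Set.Ioc (m k) v ⊆ {j | ∀ i, j ≤ m i → j ≤ b i} := by
    intro k v hv j hj i hji
    have h1 : k < i := hm.lt_iff_lt.1 (hj.1.trans_le hji)
    exact (hj.2.trans hv).trans (hb h1)
  have hlen : ∀ k, (b (k + 1) : ℝ) / 2 ≤ (b (k + 1) : ℝ) - m k := by
    intro k
    have : (2 : ℝ) * m k < b (k + 1) := by exact_mod_cast hmb k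
    linarith
  filter_upwards [Filter.eventually_ge_atTop (m 1)] with N hN
  obtain ⟨k, hk1, hk2⟩ : ∃ k, m (k + 1) ≤ N ∧ N < m (k + 2) := by
    have hex : ∃ k, N < m k := ⟨N + 1, by have := hm.id_le (N + 1); simp only [id] at this; omega⟩
    classical
    have h0 : 2 ≤ Nat.find hex := by
      by_contra! h
      have h1 := Nat.find_spec hex
      have h2 := hm.monotone (show Nat.find hex ≤ 1 by omega)
      omega
    refine ⟨Nat.find hex - 2, ?_, ?_⟩
    · have := Nat.find_min hex (m := Nat.find hex - 1) (by omega)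
      rw [show Nat.find hex - 2 + 1 = Nat.find hex - 1 by omega]
      omega
    · rw [show Nat.find hex - 2 + 2 = Nat.find hex by omega]
      exact Nat.find_spec hex
  have hN0 : (0 : ℝ) ≤ N := by positivity
  -- Only the intervals (b_i, m_i] are excluded. Just after m_{k+1} the previous interval (m_k,
  -- b_{k+1}] is used, of length at least δ m_{k+1} / 2 > δN / 4; later, the part of (m_{k+1},
  -- b_{k+2}] up to N is long enough.
  rcases lt_or_ge N (2 * m (k + 1)) with h | h
  · have h1 := hmb k
    have h2 := hbm (k + 1)
    refine ⟨m k, b (k + 1), by omega, by omega, hsub k _ le_rfl, ?_⟩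
    have h3 : (N : ℝ) < 2 * m (k + 1) := by exact_mod_cast h
    have h4 := hδm (k + 1)
    have h5 := hlen k
    nlinarith
  · rcases le_or_gt N (b (k + 2)) with h' | h'
    · refine ⟨m (k + 1), N, by omega, le_rfl, hsub (k + 1) _ h', ?_⟩
      have h3 : (2 : ℝ) * m (k + 1) ≤ N := by exact_mod_cast h
      nlinarith
    · have h1 := hmb (k + 1)
      refine ⟨m (k + 1), b (k + 2), ?_, by omega, hsub (k + 1) _ le_rfl, ?_⟩
      · change 2 * m (k + 1) < b (k + 2) at h1
        omega
      have h3 : (N : ℝ) < m (k + 2) := by exact_mod_cast hk2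
      have h4 := hδm (k + 2)
      have h5 := hlen (k + 1)
      change (b (k + 2) : ℝ) / 2 ≤ b (k + 2) - m (k + 1) at h5
      nlinarith

theorem hasFrequentlyHypercyclicSubspace_of_forall_exists {𝕜 : Type*} [RCLike 𝕜] {p : ℝ≥0∞}
    [Fact (1 ≤ p)] (hp : p ≠ ∞) {w : ℕ → 𝕜} {C : ℝ}
    (hw : ∀ n, 1 ≤ n → ‖w n‖ ≤ C) (hw0 : ∀ n, w (n + 1) ≠ 0)
    (hs : Summable fun n => ‖weightProd w n‖⁻¹ ^ p.toReal) {δ : ℝ} (hδ : 0 < δ) {C₀ : ℝ}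
    (hC₀ : 0 ≤ C₀)
    (h : ∀ B : ℕ, ∃ b m : ℕ, B ≤ b ∧ b ≤ m ∧ δ * m ≤ b ∧
      ∀ j ≤ b, ‖weightProd w m‖ ≤ C₀ * ‖weightProd w (m - j)‖) :
    HasFrequentlyHypercyclicSubspace (weightedShift p w hw) := by
  choose b m h1 h2 h3 h4 using h
  -- Each search restarts above 2m, which forces the sparseness 2 m_k < b_{k+1}.
  let g : ℕ → ℕ := fun k => (fun B => 2 * m B + 1)^[k] 0
  have hg : ∀ k, g (k + 1) = 2 * m (g k) + 1 := fun k => Function.iterate_succ_apply' _ _ _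
  have hmb : ∀ k, 2 * m (g k) < b (g (k + 1)) := by
    intro k
    have := h1 (g (k + 1))
    have := hg k
    omega
  refine hasFrequentlyHypercyclicSubspace_of_longIntervals hp hw hw0 hs (by positivity)
    (containsLongIntervals_of_gaps hδ (m := fun k => m (g k)) (b := fun k => b (g k))
      (fun k => h2 _) (fun k => h3 _) hmb) (m := fun k => m (g k)) (StrictMono.injective ?_) hC₀
    fun j hj i hji => h4 _ j (hj i hji)
  refine strictMono_nat_of_lt_succ fun k => ?_
  have := hmb k
  have := h2 (g (k + 1))
  omega

end LongIntervals

/-! ### Block weights: plateaus of the weight products. -/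

section BlockWeights

variable (𝕜 : Type*) [RCLike 𝕜] (a : ℕ → ℕ)

/-- The place of the `k`-th `4` in the block weight. -/
def blockStart (k : ℕ) : ℕ := (∑ j ∈ Finset.Ico 1 k, a j) + k

theorem blockStart_zero : blockStart a 0 = 0 := by simp [blockStart]

theorem blockStart_one : blockStart a 1 = 1 := by simp [blockStart]

theorem blockStart_succ {k : ℕ} (hk : 1 ≤ k) : blockStart a (k + 1) = blockStart a k + a k + 1 := by
  rw [blockStart, blockStart, Finset.sum_Ico_succ_top hk]
  ring

theorem blockStart_strictMono : StrictMono (blockStart a) := by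
  refine strictMono_nat_of_lt_succ fun k => ?_
  rcases Nat.eq_zero_or_pos k with rfl | hk
  · simp [blockStart_zero, blockStart_one]
  · rw [blockStart_succ a hk]
    omega

theorem blockWeight_blockStart {k : ℕ} (hk : 1 ≤ k) : blockWeight 𝕜 a (blockStart a k) = 4 :=
  if_pos ⟨k, hk, rfl⟩

theorem blockWeight_blockStart_add {k j : ℕ} (hk : 1 ≤ k) (hj : 1 ≤ j) (hj' : j ≤ a k) :
    blockWeight 𝕜 a (blockStart a k + j) = 1 := by
  refine if_neg ?_
  rintro ⟨n, -, hn⟩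
  change blockStart a k + j = blockStart a n at hn
  have h1 : k < n := (blockStart_strictMono a).lt_iff_lt.1 (by omega)
  have h2 := (blockStart_strictMono a).monotone h1
  rw [blockStart_succ a hk] at h2
  omega

theorem blockWeight_ne_zero (n : ℕ) : blockWeight 𝕜 a n ≠ 0 := by
  unfold blockWeight
  split_ifs <;> norm_num

theorem one_le_norm_blockWeight (n : ℕ) : 1 ≤ ‖blockWeight 𝕜 a n‖ := by
  unfold blockWeight
  split_ifs <;> norm_num

theorem weightProd_blockStart_add_of_eq {k : ℕ} (hk : 1 ≤ k)
    (h : weightProd (blockWeight 𝕜 a) (blockStart a k) = 4 ^ k) {j : ℕ} (hj : j ≤ a k) :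
    weightProd (blockWeight 𝕜 a) (blockStart a k + j) = 4 ^ k := by
  induction j with
  | zero => exact h
  | succ j ih =>
    rw [← add_assoc, weightProd_succ, ih (by omega), add_assoc,
      blockWeight_blockStart_add 𝕜 a hk (by omega) hj, mul_one]

theorem weightProd_blockStart (k : ℕ) : weightProd (blockWeight 𝕜 a) (blockStart a k) = 4 ^ k := by
  induction k with
  | zero => rw [blockStart_zero, weightProd_zero, pow_zero]
  | succ k ih =>
    have h4 := blockWeight_blockStart 𝕜 a (Nat.le_add_left 1 k)
    rcases Nat.eq_zero_or_pos k with rfl | hk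
    · rw [blockStart_one] at h4 ⊢
      rw [weightProd_succ, h4]
      simp
    · rw [blockStart_succ a hk] at h4 ⊢
      rw [weightProd_succ, weightProd_blockStart_add_of_eq 𝕜 a hk ih le_rfl, h4, pow_succ]

theorem norm_weightProd_blockStart_add {k : ℕ} (hk : 1 ≤ k) {j : ℕ} (hj : j ≤ a k) :
    ‖weightProd (blockWeight 𝕜 a) (blockStart a k + j)‖ = 4 ^ k := by
  rw [weightProd_blockStart_add_of_eq 𝕜 a hk (weightProd_blockStart 𝕜 a k) hj]
  simp

theorem monotone_norm_weightProd_blockWeight :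
    Monotone fun n => ‖weightProd (blockWeight 𝕜 a) n‖ := by
  refine monotone_nat_of_le_succ fun n => ?_
  rw [weightProd_succ, norm_mul]
  exact le_mul_of_one_le_right (norm_nonneg _) (one_le_norm_blockWeight 𝕜 a _)

/-- The product equals 4^k on the a_k + 1 places from the k-th four up to the next one; the leading
1 is the empty product at n = 0. -/
theorem sum_range_blockStart (q : ℝ) (K : ℕ) :
    ∑ n ∈ Finset.range (blockStart a (K + 1)), ‖weightProd (blockWeight 𝕜 a) n‖⁻¹ ^ q =
      1 + ∑ k ∈ Finset.range K, ((a (k + 1) : ℝ) + 1) / ((4 : ℝ) ^ (k + 1)) ^ q := by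
  induction K with
  | zero => simp [blockStart_one]
  | succ K ih =>
    rw [blockStart_succ a (Nat.le_add_left 1 K), add_assoc, Finset.sum_range_add, ih,
      Finset.sum_range_succ _ K, add_assoc]
    congr 2
    rw [Finset.sum_congr rfl fun j hj => ?_, Finset.sum_const, Finset.card_range, nsmul_eq_mul]
    rotate_left
    · exact (((4 : ℝ) ^ (K + 1)) ^ q)⁻¹
    · rw [norm_weightProd_blockStart_add 𝕜 a (Nat.le_add_left 1 K)
        (by have := Finset.mem_range.1 hj; omega), Real.inv_rpow (by positivity)]
    · push_cast
      rw [div_eq_mul_inv]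

variable {a}

theorem summable_weightProd_blockWeight_iff (ha : ∀ n, 1 ≤ n → 1 ≤ a n) (q : ℝ) :
    (Summable fun n => ‖weightProd (blockWeight 𝕜 a) n‖⁻¹ ^ q) ↔
      Summable fun k : ℕ => (a (k + 1) : ℝ) / ((4 : ℝ) ^ (k + 1)) ^ q := by
  have hpos : ∀ k : ℕ, (0 : ℝ) < ((4 : ℝ) ^ (k + 1)) ^ q := fun k => by positivity
  constructor
  · intro h
    refine summable_of_sum_range_le (c := ∑' n, ‖weightProd (blockWeight 𝕜 a) n‖⁻¹ ^ q)
      (fun k => by positivity) fun K => ?_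
    have h1 := h.sum_le_tsum (Finset.range (blockStart a (K + 1))) (fun n _ => by positivity)
    rw [sum_range_blockStart] at h1
    refine le_trans (Finset.sum_le_sum fun k _ => ?_) ((le_add_of_nonneg_left zero_le_one).trans h1)
    exact div_le_div_of_nonneg_right (by linarith) (hpos k).le
  · intro h
    refine summable_of_sum_range_le
      (c := 1 + ∑' k, 2 * ((a (k + 1) : ℝ) / ((4 : ℝ) ^ (k + 1)) ^ q))
      (fun k => by positivity) fun N => ?_
    have hN : N ≤ blockStart a (N + 1) := by
      unfold blockStart
      omega
    refine (Finset.sum_le_sum_of_subset_of_nonneg (Finset.range_mono hN)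
      (fun _ _ _ => by positivity)).trans ?_
    rw [sum_range_blockStart]
    refine add_le_add le_rfl (le_trans (Finset.sum_le_sum fun k _ => ?_)
      ((h.mul_left 2).sum_le_tsum (Finset.range N) (fun k _ => by positivity)))
    rw [← mul_div_assoc]
    refine div_le_div_of_nonneg_right ?_ (hpos k).le
    have : (1 : ℝ) ≤ a (k + 1) := by exact_mod_cast ha (k + 1) (by omega)
    linarith

variable (p : ℝ≥0∞) [Fact (1 ≤ p)]

theorem isFrequentlyHypercyclic_blockShift_iff (hp : p ≠ ∞) (ha : ∀ n, 1 ≤ n → 1 ≤ a n) :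
    IsFrequentlyHypercyclic (blockShift 𝕜 p a) ↔
      Summable fun k : ℕ => (a (k + 1) : ℝ) / ((4 : ℝ) ^ (k + 1)) ^ p.toReal := by
  rw [← summable_weightProd_blockWeight_iff 𝕜 ha]
  exact ⟨summable_of_isFrequentlyHypercyclic hp _ (fun n => blockWeight_ne_zero 𝕜 a _)
    (monotone_norm_weightProd_blockWeight 𝕜 a),
    isFrequentlyHypercyclic_of_summable hp _ (fun n => blockWeight_ne_zero 𝕜 a _)⟩

/-- If each block of ones is eventually at least a fixed fraction of the whole initial segment
ending with it, then a frequently hypercyclic block shift has a frequently hypercyclic subspace. -/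
theorem hasFrequentlyHypercyclicSubspace_blockShift (hp : p ≠ ∞) (ha : ∀ n, 1 ≤ n → 1 ≤ a n)
    (hs : Summable fun k : ℕ => (a (k + 1) : ℝ) / ((4 : ℝ) ^ (k + 1)) ^ p.toReal) {δ : ℝ}
    (hδ : 0 < δ) (h : ∀ᶠ n in Filter.atTop, δ * blockStart a (n + 1) ≤ a n) :
    HasFrequentlyHypercyclicSubspace (blockShift 𝕜 p a) := by
  refine hasFrequentlyHypercyclicSubspace_of_forall_exists hp _
    (fun n => blockWeight_ne_zero 𝕜 a _) ((summable_weightProd_blockWeight_iff 𝕜 ha _).2 hs) hδ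
    zero_le_one fun B => ?_
  have hB : ∀ᶠ n : ℕ in Filter.atTop, (B : ℝ) / δ ≤ n :=
    tendsto_natCast_atTop_atTop.eventually_ge_atTop _
  obtain ⟨n, h1, h2, h3⟩ := (h.and (hB.and (Filter.eventually_ge_atTop 1))).exists
  have hle : (n : ℝ) ≤ blockStart a (n + 1) := by
    have : n ≤ blockStart a (n + 1) := by
      unfold blockStart
      omega
    exact_mod_cast this
  -- m is the end of the n-th block of ones and b its length: moving back by j ≤ a n stays on the
  -- plateau, so the products agree and C₀ = 1.
  refine ⟨a n, blockStart a n + a n, ?_, Nat.le_add_left _ _, ?_, fun j hj => ?_⟩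
  · rw [div_le_iff₀ hδ] at h2
    have : (B : ℝ) ≤ a n := by nlinarith
    exact_mod_cast this
  · refine le_trans (mul_le_mul_of_nonneg_left ?_ hδ.le) h1
    have : blockStart a n + a n ≤ blockStart a (n + 1) := by
      rw [blockStart_succ a h3]
      omega
    exact_mod_cast this
  · rw [Nat.add_sub_assoc hj, norm_weightProd_blockStart_add 𝕜 a h3 le_rfl,
      norm_weightProd_blockStart_add 𝕜 a h3 (Nat.sub_le _ _), one_mul]

theorem summable_three_pow_div (hp : p ≠ ∞) :
    Summable fun k : ℕ => (((fun n => 3 ^ (n - 1) : ℕ → ℕ) (k + 1) : ℕ) : ℝ) /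
      ((4 : ℝ) ^ (k + 1)) ^ p.toReal := by
  have hq : 1 ≤ p.toReal := by
    have := (ENNReal.toReal_le_toReal ENNReal.one_ne_top hp).2 (Fact.out : 1 ≤ p)
    simpa using this
  refine Summable.of_nonneg_of_le (fun k => by positivity) (fun k => ?_)
    (summable_geometric_of_lt_one (r := (3 / 4 : ℝ)) (by norm_num) (by norm_num))
  have h1 : (1 : ℝ) ≤ 4 ^ (k + 1) := one_le_pow₀ (by norm_num)
  have h2 : (4 : ℝ) ^ (k + 1) ≤ ((4 : ℝ) ^ (k + 1)) ^ p.toReal := Real.self_le_rpow_of_one_le h1 hq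
  have h3 : (4 : ℝ) ^ k ≤ 4 ^ (k + 1) := pow_le_pow_right₀ (by norm_num) (Nat.le_succ k)
  rw [div_pow]
  simp only [Nat.add_sub_cancel]
  push_cast
  exact div_le_div_of_nonneg_left (by positivity) (by positivity) (h3.trans h2)

theorem blockStart_three_pow_le {n : ℕ} (hn : 1 ≤ n) :
    blockStart (fun n => 3 ^ (n - 1)) (n + 1) ≤ 3 * 3 ^ (n - 1) := by
  induction n, hn using Nat.le_induction with
  | base => simp [blockStart]
  | succ n hn ih =>
    rw [blockStart_succ _ (by omega)]
    simp only [Nat.add_sub_cancel]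
    have h1 : 3 ^ n = 3 * 3 ^ (n - 1) := by
      rw [← pow_succ', Nat.sub_add_cancel hn]
    have h2 : 0 < 3 ^ n := by positivity
    omega

end BlockWeights

/-! ### The theorem. -/

theorem mainTheorem2 {𝕜 : Type*} [RCLike 𝕜] (p : ℝ≥0∞) [Fact (1 ≤ p)] (hp : p ≠ ∞) :
    (∀ a : ℕ → ℕ, (∀ n, 1 ≤ n → 1 ≤ a n) → MonotoneOn a (Set.Ici 1) →
      (IsFrequentlyHypercyclic (blockShift 𝕜 p a) ↔
        Summable fun k : ℕ => (a (k + 1) : ℝ) / ((4 : ℝ) ^ (k + 1)) ^ p.toReal) ∧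
      ((Summable fun k : ℕ => (a (k + 1) : ℝ) / ((4 : ℝ) ^ (k + 1)) ^ p.toReal) →
        0 < Filter.liminf (fun n : ℕ =>
          ((a n : ℝ) - (∑ k ∈ Finset.Ico 1 n, (a k : ℝ)) - (n : ℝ)) /
            ((∑ k ∈ Finset.Icc 1 n, (a k : ℝ)) + ((n : ℝ) + 1))) Filter.atTop →
        HasFrequentlyHypercyclicSubspace (blockShift 𝕜 p a))) ∧
    IsFrequentlyHypercyclic (blockShift 𝕜 p fun n => 3 ^ (n - 1)) ∧
    HasFrequentlyHypercyclicSubspace (blockShift 𝕜 p fun n => 3 ^ (n - 1)) := by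
  have h3 : ∀ n : ℕ, 1 ≤ n → 1 ≤ (fun n => 3 ^ (n - 1) : ℕ → ℕ) n :=
    fun n _ => Nat.one_le_pow _ _ (by norm_num)
  refine ⟨fun a ha _ => ⟨isFrequentlyHypercyclic_blockShift_iff 𝕜 p hp ha, fun hs h => ?_⟩,
    (isFrequentlyHypercyclic_blockShift_iff 𝕜 p hp h3).2 (summable_three_pow_div p hp),
    hasFrequentlyHypercyclicSubspace_blockShift 𝕜 p hp h3 (summable_three_pow_div p hp)
      (δ := 1 / 3) (by norm_num) ?_⟩
  · obtain ⟨δ, hδ, hev⟩ := exists_pos_eventually_le_of_liminf_pos h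
    refine hasFrequentlyHypercyclicSubspace_blockShift 𝕜 p hp ha hs hδ (hev.mono fun n hn => ?_)
    -- Dropping the subtracted terms leaves the lower bound for a n alone, which is all that is
    -- needed.
    have h1 : (0 : ℝ) ≤ ∑ k ∈ Finset.Ico 1 n, (a k : ℝ) := by positivity
    rw [le_div_iff₀ (by positivity)] at hn
    have h2 : (blockStart a (n + 1) : ℝ) = (∑ k ∈ Finset.Icc 1 n, (a k : ℝ)) + ((n : ℝ) + 1) := by
      unfold blockStart
      rw [Finset.Ico_add_one_right_eq_Icc]
      push_cast
      rfl
    rw [h2]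
    have h3 : (0 : ℝ) ≤ n := by positivity
    linarith
  · filter_upwards [Filter.eventually_ge_atTop 1] with n hn
    have h1 : ((blockStart (fun n => 3 ^ (n - 1)) (n + 1) : ℕ) : ℝ) ≤
        ((3 * 3 ^ (n - 1) : ℕ) : ℝ) := by exact_mod_cast blockStart_three_pow_le hn
    push_cast at h1 ⊢
    linarith
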